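/- Theorem 1.14. Let $\Lambda$ be the Kauffman polynomial of regular isotopy of unoriented link diagrams in the plane. It assigns to each nonempty diagram $D$ a Laurent polynomial $\Lambda_D(a,x)\in\mathbb Z[a^{\pm1},x^{\pm1}]$. It is invariant under regular isotopy, that is, under isotopy of the plane and the second and third Reidemeister moves. It equals $1$ on the crossingless circle. Introducing a curl of sign $\pm1$ into a diagram (a first Reidemeister move) multiplies $\Lambda$ by $a^{\pm1}$. (Hence $\Lambda_T=a^{\mathrm{tw}(T)}$ for each diagram $T$ of the trivial knot, where $\mathrm{tw}(T)$ is the sum of the signs of the crossings.) Finally, $\Lambda_{D_{+}}+\Lambda_{D_{-}}=x\Lambda_{D_0}+x\Lambda_{D_\infty}$ whenever the four diagrams are identical outside a disc, and inside the disc consist of two vertical strands with one positive half twist ($D_+$), one negative half twist ($D_-$) or no twist ($D_0$), or of the smoothing by a maximum below a minimum ($D_\infty$). Here a half twist is called positive if its crossing is positive when both strands are oriented upwards. For $k\ge 0$ let $D_k$ be the diagram which is identical with $D_0$ outside the disc and has two vertical strands with $k$ positive half twists inside it (so $D_1=D_+$). Then for all $k\ge 0$ $$\Lambda_{D_k}(a,x)=v_1^{(k)}(x)\,\Lambda_{D_1}(a,x)-v_1^{(k-1)}(x)\,\Lambda_{D_0}(a,x)+x\,v_2^{(k)}(a,x)\,\Lambda_{D_\infty}(a,x).$$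 Here $v_1^{(-1)}=-1$, $v_1^{(0)}=0$, $v_1^{(1)}=1$, $v_1^{(k+2)}=x v_1^{(k+1)}-v_1^{(k)}$ (which defines $v_1^{(k)}$ for all integers $k$), and $v_2^{(0)}=v_2^{(1)}=0$, $v_2^{(2)}=a^{-1}$, $v_2^{(k)}=x v_2^{(k-1)}-v_2^{(k-2)}+a^{1-k}$ for $k\ge 2$. The same formula holds for the classes of the diagrams in the Kauffman skein module, i.e. the $\mathbb Z[a^{\pm1},x^{\pm1}]$-module generated by all diagrams modulo the linear relations above (regular isotopy, curls, skein relation). In particular, for $x=p+p^{-1}$, with $a$, $p$ nonzero elements of any field, $$v_1^{(k)}=\frac{p^k-p^{-k}}{p-p^{-1}}\quad(k\in\mathbb Z),\qquad v_2^{(k)}=\frac{-a^{-1}(p^k-p^{-k})+p(a^{-k}-p^{-k})-p^{-1}(a^{-k}-p^{k})}{(p-p^{-1})\,(a+a^{-1}-(p+p^{-1}))}\quad(k\ge 0)$$ whenever the denominators do not vanish. -/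

import Mathlib

/-! Unoriented link diagrams in the plane, in Morse position with respect to the height function.
Such a diagram is read from bottom to top as a finite sequence of elementary slices. -/

namespace KauffmanTwist

/-- The elementary pieces of a plane link diagram: a local minimum, a local maximum, and the two
kinds of crossing of two strands. In `pos` the strand running from the lower left to the upper
right is the over-strand (so the crossing is positive when both strands are oriented upwards);
in `neg` the strand running from the lower right to the upper left is the over-strand. -/
inductive Piece : Type
  | cup
  | cap
  | pos
  | neg

/-- Number of strands entering a piece from below. -/
def Piece.dom : Piece → ℕ
  | .cup => 0
  | .cap => 2
  | .pos => 2
  | .neg => 2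

/-- Number of strands leaving a piece at the top. -/
def Piece.cod : Piece → ℕ
  | .cup => 2
  | .cap => 0
  | .pos => 2
  | .neg => 2

/-- A horizontal slice `(s, i)` of a diagram: the piece `s`, with exactly `i` vertical strands to
the left of it (and any number of vertical strands to the right of it). -/
abbrev Slice : Type := Piece × ℕ

/-- `strands w n` is the number of strands at the top of the stack of slices `w` (listed from
bottom to top) over `n` strands; it is `none` if the slices do not fit. -/
def strands : List Slice → ℕ → Option ℕ
  | [], n => some n
  | (s, i) :: w, n => if i + s.dom ≤ n then strands w (n - s.dom + s.cod) else none

/-- An unoriented (nonempty) link diagram. -/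
structure LinkDiagram : Type where
  word : List Slice
  closed : strands word 0 = some 0
  nonempty : word ≠ []

/-- The local moves that generate regular isotopy: isotopy of the plane (exchange of the heights
of two pieces side by side, cancellation of a maximum and a minimum, a strand sliding past a
maximum or a minimum) and the second and third Reidemeister moves. -/
inductive LocalMove : List Slice → List Slice → Prop
  | exchange (s t : Piece) (i m : ℕ) :
      LocalMove [(s, i), (t, i + s.cod + m)] [(t, i + s.dom + m), (s, i)]
  | zigzag_right (i : ℕ) : LocalMove [(.cup, i + 1), (.cap, i)] []
  | zigzag_left (i : ℕ) : LocalMove [(.cup, i), (.cap, i + 1)] []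
  | cap_slide_pos (i : ℕ) : LocalMove [(.pos, i + 1), (.cap, i)] [(.neg, i), (.cap, i + 1)]
  | cap_slide_neg (i : ℕ) : LocalMove [(.neg, i + 1), (.cap, i)] [(.pos, i), (.cap, i + 1)]
  | cup_slide_pos (i : ℕ) : LocalMove [(.cup, i), (.pos, i + 1)] [(.cup, i + 1), (.neg, i)]
  | cup_slide_neg (i : ℕ) : LocalMove [(.cup, i), (.neg, i + 1)] [(.cup, i + 1), (.pos, i)]
  | reidemeister_two_pos_neg (i : ℕ) : LocalMove [(.pos, i), (.neg, i)] []
  | reidemeister_two_neg_pos (i : ℕ) : LocalMove [(.neg, i), (.pos, i)] []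
  | reidemeister_three (i : ℕ) :
      LocalMove [(.pos, i), (.pos, i + 1), (.pos, i)] [(.pos, i + 1), (.pos, i), (.pos, i + 1)]

/-- Two diagrams differ by one local move: they agree below and above it. -/
def RegularMove (D D' : LinkDiagram) : Prop :=
  ∃ u l r v : List Slice, LocalMove l r ∧ D.word = u ++ l ++ v ∧ D'.word = u ++ r ++ v

/-- Regular isotopy of diagrams. -/
def RegularlyIsotopic : LinkDiagram → LinkDiagram → Prop := Relation.EqvGen RegularMove

/-- `AddsCurl c D D'`: the diagram `D'` arises from `D` by a first Reidemeister move which puts a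
curl with the crossing `c` on an arc of `D` at a local maximum. The two strands of a curl point in
opposite vertical directions at the crossing, whatever the orientation; so the curl with `pos` has
sign `-1` and the curl with `neg` has sign `+1`. (By regular isotopy, every curl can be brought
into this position.) -/
def AddsCurl (c : Piece) (D D' : LinkDiagram) : Prop :=
  ∃ (u v : List Slice) (i : ℕ),
    D.word = u ++ [(.cap, i)] ++ v ∧ D'.word = u ++ [(c, i), (.cap, i)] ++ v

/-- The diagram of the trivial knot without crossings. -/
def circle : LinkDiagram where
  word := [(.cup, 0), (.cap, 0)]
  closed := by simp [strands, Piece.dom, Piece.cod]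
  nonempty := by simp

theorem strands_append (w w' : List Slice) (n : ℕ) :
    strands (w ++ w') n = (strands w n).bind (strands w') := by
  induction w generalizing n with
  | nil => simp [strands]
  | cons s w ih =>
    obtain ⟨s, i⟩ := s
    simp only [List.cons_append, strands]
    split_ifs <;> simp [ih]

/-- The exterior of a disc in the plane that meets a link diagram in two vertical strands (at
heights between those of `below` and `above`): the two strands have `i` strands to their left,
among `n` strands in total. -/
structure Exterior : Type where
  below : List Slice
  above : List Slice
  n : ℕ
  i : ℕ
  fits : i + 2 ≤ n
  strands_below : strands below 0 = some n
  strands_above : strands above n = some 0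

/-- The diagram obtained by filling the disc with a stack `t` of slices. -/
def Exterior.fill (E : Exterior) (t : List Slice) (ht : strands t E.n = some E.n) :
    LinkDiagram where
  word := E.below ++ t ++ E.above
  closed := by simp [strands_append, E.strands_below, ht, E.strands_above]
  nonempty := by
    have h := E.strands_below
    have h2 := E.fits
    intro hw
    have hb : E.below = [] := by simp_all
    rw [hb] at h
    simp only [strands, Option.some.injEq] at h
    omega

theorem strands_replicate {s : Piece} (hs : s.dom = 2) (hs' : s.cod = 2) {i n : ℕ}
    (h : i + 2 ≤ n) (k : ℕ) : strands (List.replicate k (s, i)) n = some n := by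
  induction k with
  | zero => simp [strands]
  | succ k ih =>
    have hn : n - 2 + 2 = n := by omega
    simp [List.replicate_succ, strands, hs, hs', h, hn, ih]

/-- The disc is filled with two strands twisted around each other by `k` positive half twists. -/
def Exterior.twist (E : Exterior) (k : ℕ) : LinkDiagram :=
  E.fill (List.replicate k (.pos, E.i)) (strands_replicate rfl rfl E.fits k)

/-- The disc is filled with one negative half twist. -/
def Exterior.negTwist (E : Exterior) : LinkDiagram :=
  E.fill [(.neg, E.i)] (strands_replicate (s := .neg) rfl rfl E.fits 1)

/-- The disc is filled with the horizontal smoothing: a maximum below a minimum. -/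
def Exterior.infty (E : Exterior) : LinkDiagram :=
  E.fill [(.cap, E.i), (.cup, E.i)] (by
    have h := E.fits
    have h2 : E.i ≤ E.n - 2 := by omega
    have h3 : E.n - 2 + 2 = E.n := by omega
    simp [strands, Piece.dom, Piece.cod, h, h2, h3])

/-- The ring of Laurent polynomials in the two variables `a` and `x` with integer coefficients. -/
def Laurent : Type := LaurentPolynomial (LaurentPolynomial ℤ)

noncomputable instance : CommRing Laurent :=
  inferInstanceAs (CommRing (LaurentPolynomial (LaurentPolynomial ℤ)))

/-- The variable `a`, as a unit. -/
noncomputable def a : Laurentˣ :=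
  (show (LaurentPolynomial (LaurentPolynomial ℤ))ˣ from
    { val := LaurentPolynomial.C (LaurentPolynomial.T 1)
      inv := LaurentPolynomial.C (LaurentPolynomial.T (-1))
      val_inv := by rw [← map_mul, ← LaurentPolynomial.T_add]; simp
      inv_val := by rw [← map_mul, ← LaurentPolynomial.T_add]; simp })

/-- The variable `x`. -/
noncomputable def x : Laurent :=
  (LaurentPolynomial.T 1 : LaurentPolynomial (LaurentPolynomial ℤ))

/-- `Λ` is the Kauffman polynomial of regular isotopy of unoriented diagrams, given by Kauffman's
defining properties: invariance under regular isotopy, value `1` on the circle, a curl of sign `±1`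
multiplies the value by `a ^ (±1)`, and the skein relation. (Every first Reidemeister move changes
the writhe `tw` by the sign of the curl, so on a diagram `T` of the trivial knot the value is
`a ^ tw T`.) -/
structure IsKauffmanPolynomial (Λ : LinkDiagram → Laurent) : Prop where
  regular_isotopy : ∀ D D' : LinkDiagram, RegularlyIsotopic D D' → Λ D = Λ D'
  circle : Λ circle = 1
  curl_pos : ∀ D D' : LinkDiagram, AddsCurl .neg D D' → Λ D' = (a : Laurent) * Λ D
  curl_neg : ∀ D D' : LinkDiagram, AddsCurl .pos D D' → Λ D' = ((a⁻¹ : Laurentˣ) : Laurent) * Λ D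
  skein : ∀ E : Exterior, Λ (E.twist 1) + Λ E.negTwist = x * Λ (E.twist 0) + x * Λ E.infty

/-- The same relations as linear relations between diagrams. -/
inductive SkeinRelation : (LinkDiagram →₀ Laurent) → Prop
  | regular_isotopy (D D' : LinkDiagram) (h : RegularlyIsotopic D D') :
      SkeinRelation (Finsupp.single D 1 - Finsupp.single D' 1)
  | curl_pos (D D' : LinkDiagram) (h : AddsCurl .neg D D') :
      SkeinRelation (Finsupp.single D' 1 - (a : Laurent) • Finsupp.single D 1)
  | curl_neg (D D' : LinkDiagram) (h : AddsCurl .pos D D') :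
      SkeinRelation (Finsupp.single D' 1 - ((a⁻¹ : Laurentˣ) : Laurent) • Finsupp.single D 1)
  | skein (E : Exterior) :
      SkeinRelation (Finsupp.single (E.twist 1) 1 + Finsupp.single E.negTwist 1
        - (x • Finsupp.single (E.twist 0) 1 + x • Finsupp.single E.infty 1))

/-- The Kauffman skein module of the plane: the module generated by all diagrams, modulo the
skein relations. The Kauffman polynomials are the linear maps from this module to the ring of
Laurent polynomials that send the class of the circle to `1`. -/
abbrev SkeinModule : Type :=
  (LinkDiagram →₀ Laurent) ⧸ Submodule.span Laurent {r | SkeinRelation r}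

/-- The class of a diagram in the skein module. -/
noncomputable def skeinClass (D : LinkDiagram) : SkeinModule :=
  Submodule.Quotient.mk (Finsupp.single D 1)

/-- The sequence `v₁` at indices `k ≥ 0`. -/
def v₁Nat {R : Type*} [CommRing R] (y : R) : ℕ → R
  | 0 => 0
  | 1 => 1
  | k + 2 => y * v₁Nat y (k + 1) - v₁Nat y k

/-- The sequence `v₁`, extended to negative indices as the recurrence forces. -/
def v₁ {R : Type*} [CommRing R] (y : R) : ℤ → R
  | .ofNat k => v₁Nat y k
  | .negSucc k => -v₁Nat y (k + 1)

/-- The sequence `v₂`. -/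
def v₂ {R : Type*} [CommRing R] (b : Rˣ) (y : R) : ℕ → R
  | 0 => 0
  | 1 => 0
  | k + 2 => y * v₂ b y (k + 1) - v₂ b y k + ((b ^ (1 - ((k + 2 : ℕ) : ℤ)) : Rˣ) : R)

end KauffmanTwist

namespace KauffmanTwist

/-! Apply the skein relation in a smaller disc that contains only the topmost crossing of the twist,
with `k + 1` positive half twists left below it. Its four diagrams are the twist with `k + 2` half
twists, the twist with `k` (after a second Reidemeister move), the twist with `k + 1`, and a maximum
that turns the `k + 1` crossings into curls of sign `-1`, each worth a factor `a⁻¹`. Hence `f (k +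
2) = x f (k + 1) - f k + x a ^ (-(k + 1)) f ∞` (`twist_add_two`). This is a linear recurrence of
order two: `v₁` and its shift solve the homogeneous part with the two initial values, and `v₂`
absorbs the inhomogeneous term (`twist_eq`).

The argument is linear, so it is carried out for invariants with values in any module; the Kauffman
polynomial and the class in the skein module are two instances. The closed forms come from the
characteristic roots `p` and `p⁻¹` of the recurrence. -/

/-- A diagram invariant with values in a module that satisfies Kauffman's skein relations, without
a normalization. -/
structure IsSkeinInvariant {M : Type*} [AddCommGroup M] [Module Laurent M]
    (f : LinkDiagram → M) : Prop where
  regular_isotopy : ∀ D D' : LinkDiagram, RegularlyIsotopic D D' → f D = f D'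
  curl_neg : ∀ D D' : LinkDiagram, AddsCurl .pos D D' → f D' = ((a⁻¹ : Laurentˣ) : Laurent) • f D
  skein : ∀ E : Exterior, f (E.twist 1) + f E.negTwist = x • f (E.twist 0) + x • f E.infty

theorem IsKauffmanPolynomial.isSkeinInvariant {Λ : LinkDiagram → Laurent}
    (h : IsKauffmanPolynomial Λ) : IsSkeinInvariant Λ where
  regular_isotopy := h.regular_isotopy
  curl_neg := h.curl_neg
  skein := h.skein

theorem isSkeinInvariant_skeinClass : IsSkeinInvariant skeinClass where
  regular_isotopy D D' h :=
    (Submodule.Quotient.eq _).2 (Submodule.subset_span (.regular_isotopy D D' h))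
  curl_neg D D' h := (Submodule.Quotient.eq _).2 (Submodule.subset_span (.curl_neg D D' h))
  skein E := (Submodule.Quotient.eq _).2 (Submodule.subset_span (.skein E))

/-- The exterior of a smaller disc, which leaves `k` positive half twists below it. -/
def Exterior.shrink (E : Exterior) (k : ℕ) : Exterior where
  below := E.below ++ List.replicate k (.pos, E.i)
  above := E.above
  n := E.n
  i := E.i
  fits := E.fits
  strands_below := by
    simp [strands_append, E.strands_below, strands_replicate (s := .pos) rfl rfl E.fits k]
  strands_above := E.strands_above

theorem LinkDiagram.ext_word {D D' : LinkDiagram} (h : D.word = D'.word) : D = D' := by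
  cases D
  cases D'
  cases h
  rfl

theorem Exterior.shrink_twist (E : Exterior) (k l : ℕ) :
    (E.shrink k).twist l = E.twist (k + l) :=
  LinkDiagram.ext_word (by simp [shrink, twist, fill])

theorem Exterior.shrink_zero_infty (E : Exterior) : (E.shrink 0).infty = E.infty :=
  LinkDiagram.ext_word (by simp [shrink, infty, fill])

/-- The negative half twist cancels the uppermost of the positive ones below it. -/
theorem Exterior.shrink_succ_negTwist (E : Exterior) (k : ℕ) :
    RegularlyIsotopic (E.shrink (k + 1)).negTwist (E.twist k) :=
  .rel _ _ ⟨E.below ++ List.replicate k (.pos, E.i), _, _, E.above,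
    .reidemeister_two_pos_neg E.i,
    by simp [shrink, negTwist, fill, List.replicate_succ'], by simp [twist, fill]⟩

/-- The maximum of the smoothing joins the upper ends of the crossing just below it, which thereby
becomes a curl. -/
theorem Exterior.shrink_succ_infty (E : Exterior) (k : ℕ) :
    AddsCurl .pos (E.shrink k).infty (E.shrink (k + 1)).infty :=
  ⟨E.below ++ List.replicate k (.pos, E.i), (.cup, E.i) :: E.above, E.i,
    by simp [shrink, infty, fill], by simp [shrink, infty, fill, List.replicate_succ']⟩

theorem v₁_add_two {R : Type*} [CommRing R] (y : R) (k : ℤ) :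
    v₁ y (k + 2) = y * v₁ y (k + 1) - v₁ y k := by
  match k with
  | .ofNat k => rfl
  | .negSucc 0 =>
    change (1 : R) = y * 0 - -1
    ring
  | .negSucc 1 =>
    change (0 : R) = y * -1 - -(y * 1 - 0)
    ring
  | .negSucc (k + 2) =>
    have h1 : Int.negSucc (k + 2) + 2 = Int.negSucc k := by omega
    have h2 : Int.negSucc (k + 2) + 1 = Int.negSucc (k + 1) := by omega
    rw [h1, h2]
    change -v₁Nat y (k + 1)
      = y * -v₁Nat y (k + 2) - -(y * v₁Nat y (k + 2) - v₁Nat y (k + 1))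
    ring

theorem v₁_neg_one {R : Type*} [CommRing R] (y : R) : v₁ y (-1) = -1 := rfl

theorem v₁_zero {R : Type*} [CommRing R] (y : R) : v₁ y 0 = 0 := rfl

theorem v₁_one {R : Type*} [CommRing R] (y : R) : v₁ y 1 = 1 := rfl

theorem v₂_add_two {R : Type*} [CommRing R] (b : Rˣ) (y : R) (k : ℕ) :
    v₂ b y (k + 2) = y * v₂ b y (k + 1) - v₂ b y k + ((b⁻¹ ^ (k + 1) : Rˣ) : R) := by
  have h : b ^ (1 - ((k + 2 : ℕ) : ℤ)) = b⁻¹ ^ (k + 1) := by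
    rw [inv_pow, ← zpow_natCast, ← zpow_neg]
    congr 1
  rw [v₂, h]

namespace IsSkeinInvariant

variable {M : Type*} [AddCommGroup M] [Module Laurent M] {f : LinkDiagram → M}

theorem shrink_infty (hf : IsSkeinInvariant f) (E : Exterior) (k : ℕ) :
    f (E.shrink k).infty = ((a⁻¹ ^ k : Laurentˣ) : Laurent) • f E.infty := by
  induction k with
  | zero => simp [E.shrink_zero_infty]
  | succ k ih =>
    rw [hf.curl_neg _ _ (E.shrink_succ_infty k), ih, smul_smul, pow_succ', Units.val_mul]

theorem twist_add_two (hf : IsSkeinInvariant f) (E : Exterior) (k : ℕ) :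
    f (E.twist (k + 2)) = x • f (E.twist (k + 1)) - f (E.twist k)
      + (x * ((a⁻¹ ^ (k + 1) : Laurentˣ) : Laurent)) • f E.infty := by
  have h := hf.skein (E.shrink (k + 1))
  rw [E.shrink_twist, E.shrink_twist, hf.regular_isotopy _ _ (E.shrink_succ_negTwist k),
    hf.shrink_infty, smul_smul] at h
  -- `add_zero` is for the twist number `k + 1 + 0` left by the untwisted filling.
  rw [eq_sub_of_add_eq h, add_zero]
  abel

theorem twist_eq (hf : IsSkeinInvariant f) (E : Exterior) (k : ℕ) :
    f (E.twist k) = v₁ x k • f (E.twist 1) - v₁ x (k - 1) • f (E.twist 0)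
      + (x * v₂ a x k) • f E.infty := by
  induction k using Nat.twoStepInduction with
  | zero => simp [v₁_zero, v₁_neg_one, v₂]
  | one => simp [v₁_zero, v₁_one, v₂]
  | more k ih ih' =>
    have h1 : ((k + 2 : ℕ) : ℤ) = (k : ℤ) + 2 := by push_cast; rfl
    have h2 : ((k + 1 : ℕ) : ℤ) = (k : ℤ) + 1 := by push_cast; rfl
    -- The shifted coefficient obeys the recurrence starting at index `k - 1`, which is `-1` for `k
    -- = 0`; this is where the extension of `v₁` to negative indices enters.
    have h3 : (k : ℤ) + 2 - 1 = ((k : ℤ) - 1) + 2 := by ring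
    have h4 : (k : ℤ) + 1 - 1 = ((k : ℤ) - 1) + 1 := by ring
    rw [h2, h4] at ih'
    rw [hf.twist_add_two, ih, ih', h1, h3, v₁_add_two, v₁_add_two, v₂_add_two]
    module

end IsSkeinInvariant

theorem v₁_closed_form {K : Type*} [Field K] {p : K} (hp : p ≠ 0) (hp' : p - p⁻¹ ≠ 0) (k : ℤ) :
    v₁ (p + p⁻¹) k = (p ^ k - p ^ (-k)) / (p - p⁻¹) := by
  have step (k : ℤ) : (p ^ (k + 2) - p ^ (-(k + 2))) / (p - p⁻¹)
      = (p + p⁻¹) * ((p ^ (k + 1) - p ^ (-(k + 1))) / (p - p⁻¹))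
        - (p ^ k - p ^ (-k)) / (p - p⁻¹) := by
    rw [← mul_div_assoc, ← sub_div]
    congr 1
    simp only [neg_add, zpow_add₀ hp, zpow_neg, zpow_ofNat]
    field_simp
    ring
  -- Two consecutive values determine the sequence in both directions, so the induction carries
  -- pairs.
  suffices h : ∀ k : ℤ, v₁ (p + p⁻¹) k = (p ^ k - p ^ (-k)) / (p - p⁻¹) ∧
      v₁ (p + p⁻¹) (k + 1) = (p ^ (k + 1) - p ^ (-(k + 1))) / (p - p⁻¹) from (h k).1
  intro k
  induction k using Int.induction_on with
  | zero => simp [v₁_zero, v₁_one, div_self hp']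
  | succ k ih =>
    refine ⟨ih.2, ?_⟩
    have e : (k : ℤ) + 1 + 1 = k + 2 := by ring
    rw [e, v₁_add_two, step, ih.1, ih.2]
  | pred k ih =>
    have e : -(k : ℤ) - 1 + 1 = -k := by ring
    have e' : -(k : ℤ) - 1 + 2 = -k + 1 := by ring
    have h1 := v₁_add_two (p + p⁻¹) (-(k : ℤ) - 1)
    have h2 := step (-(k : ℤ) - 1)
    rw [e, e', ih.1, ih.2] at h1
    rw [e, e'] at h2
    rw [e]
    exact ⟨by linear_combination h1 - h2, ih.1⟩

/-- Since `b⁻² - (p + p⁻¹) b⁻¹ + 1 = b⁻¹ (b + b⁻¹ - (p + p⁻¹))`, the sequence `b ^ (-k) / (b + b⁻¹ -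
(p + p⁻¹))` is a particular solution; the multiples of `p ^ k` and `p ^ (-k)` adjust the values at
`0` and `1`. -/
theorem v₂_closed_form {K : Type*} [Field K] (b : Kˣ) {p : K} (hp : p ≠ 0) (hp' : p - p⁻¹ ≠ 0)
    (hb : (b : K) + (b : K)⁻¹ - (p + p⁻¹) ≠ 0) (k : ℕ) :
    v₂ b (p + p⁻¹) k = ((p - p⁻¹) * ((b : K) + (b : K)⁻¹ - (p + p⁻¹)))⁻¹ *
      (-(b : K)⁻¹ * (p ^ (k : ℤ) - p ^ (-(k : ℤ)))
        + p * ((b : K) ^ (-(k : ℤ)) - p ^ (-(k : ℤ)))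
        - p⁻¹ * ((b : K) ^ (-(k : ℤ)) - p ^ (k : ℤ))) := by
  have hb0 : (b : K) ≠ 0 := b.ne_zero
  rw [eq_inv_mul_iff_mul_eq₀ (mul_ne_zero hp' hb)]
  simp only [zpow_neg, zpow_natCast, ← inv_pow]
  induction k using Nat.twoStepInduction with
  | zero => simp [v₂]
  | one =>
    simp only [v₂, pow_one]
    field_simp
    ring
  | more k ih ih' =>
    rw [v₂_add_two, mul_add, mul_sub, mul_left_comm, ih, ih']
    push_cast
    simp only [pow_succ]
    have h1 : p * p⁻¹ = 1 := mul_inv_cancel₀ hp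
    have h2 : (b : K) * (b : K)⁻¹ = 1 := mul_inv_cancel₀ hb0
    -- With the inverses as independent variables, the claim is a polynomial identity modulo `p q =
    -- 1` and `d c = 1`.
    generalize (b : K)⁻¹ = c at *
    generalize p⁻¹ = q at *
    generalize (b : K) = d at *
    linear_combination ((q - c) * p ^ k + (c - p) * q ^ k) * h1 + (p - q) * c ^ k * h2

end KauffmanTwist

theorem theorem1p14 :
    -- the formula for the Kauffman polynomial
    (∀ Λ : KauffmanTwist.LinkDiagram → KauffmanTwist.Laurent,
      KauffmanTwist.IsKauffmanPolynomial Λ →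
      ∀ (E : KauffmanTwist.Exterior) (k : ℕ),
        Λ (E.twist k) =
          KauffmanTwist.v₁ KauffmanTwist.x k * Λ (E.twist 1)
          - KauffmanTwist.v₁ KauffmanTwist.x (k - 1) * Λ (E.twist 0)
          + KauffmanTwist.x * KauffmanTwist.v₂ KauffmanTwist.a KauffmanTwist.x k * Λ E.infty) ∧
    -- the same formula already holds for the classes of the diagrams in the skein module
    (∀ (E : KauffmanTwist.Exterior) (k : ℕ),
        KauffmanTwist.skeinClass (E.twist k) =
          KauffmanTwist.v₁ KauffmanTwist.x k • KauffmanTwist.skeinClass (E.twist 1)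
          - KauffmanTwist.v₁ KauffmanTwist.x (k - 1) • KauffmanTwist.skeinClass (E.twist 0)
          + (KauffmanTwist.x * KauffmanTwist.v₂ KauffmanTwist.a KauffmanTwist.x k) •
              KauffmanTwist.skeinClass E.infty) ∧
    -- the recurrences
    (∀ (R : Type*) [CommRing R] (b : Rˣ) (y : R),
      KauffmanTwist.v₁ y (-1) = -1 ∧ KauffmanTwist.v₁ y 0 = 0 ∧ KauffmanTwist.v₁ y 1 = 1 ∧
      (∀ k : ℤ, KauffmanTwist.v₁ y (k + 2)
        = y * KauffmanTwist.v₁ y (k + 1) - KauffmanTwist.v₁ y k) ∧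
      KauffmanTwist.v₂ b y 0 = 0 ∧ KauffmanTwist.v₂ b y 1 = 0 ∧
      KauffmanTwist.v₂ b y 2 = ((b⁻¹ : Rˣ) : R) ∧
      (∀ k : ℕ, 2 ≤ k → KauffmanTwist.v₂ b y k
        = y * KauffmanTwist.v₂ b y (k - 1) - KauffmanTwist.v₂ b y (k - 2)
          + ((b ^ (1 - (k : ℤ)) : Rˣ) : R))) ∧
    -- the closed forms at `p + p⁻¹`
    (∀ (K : Type*) [Field K] (b : Kˣ) (p : K), p ≠ 0 → p - p⁻¹ ≠ 0 →
      (∀ k : ℤ, KauffmanTwist.v₁ (p + p⁻¹) k = (p ^ k - p ^ (-k)) / (p - p⁻¹)) ∧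
      ((b : K) + (b : K)⁻¹ - (p + p⁻¹) ≠ 0 →
        ∀ k : ℕ, KauffmanTwist.v₂ b (p + p⁻¹) k =
          ((p - p⁻¹) * ((b : K) + (b : K)⁻¹ - (p + p⁻¹)))⁻¹ *
            (-(b : K)⁻¹ * (p ^ (k : ℤ) - p ^ (-(k : ℤ)))
              + p * ((b : K) ^ (-(k : ℤ)) - p ^ (-(k : ℤ)))
              - p⁻¹ * ((b : K) ^ (-(k : ℤ)) - p ^ (k : ℤ))))) := by
  refine ⟨fun Λ hΛ E k => hΛ.isSkeinInvariant.twist_eq E k,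
    fun E k => KauffmanTwist.isSkeinInvariant_skeinClass.twist_eq E k, ?_, ?_⟩
  · intro R _ b y
    refine ⟨rfl, rfl, rfl, KauffmanTwist.v₁_add_two y, rfl, rfl, ?_, ?_⟩
    · rw [KauffmanTwist.v₂_add_two]
      simp [KauffmanTwist.v₂]
    · intro k hk
      obtain ⟨k, rfl⟩ := Nat.exists_eq_add_of_le' hk
      rfl
  · intro K _ b p hp hp'
    exact ⟨KauffmanTwist.v₁_closed_form hp hp', KauffmanTwist.v₂_closed_form b hp hp'⟩
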